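/- Let $n\ge 1$ be an integer, and let $\mathcal{H}_n$ be the $0$-Hecke monoid of the symmetric group $S_n$, that is, the monoid generated by $e_1,\dots,e_{n-1}$ subject to the relations $$e_i^2=e_i\quad(1\le i\le n-1),\qquad e_ie_j=e_je_i\quad(i\ne j\pm 1),\qquad e_ie_{i+1}e_i=e_{i+1}e_ie_{i+1}\quad(1\le i\le n-2).$$ Let $\Bbbk$ be any field. A linear representation of $\mathcal{H}_n$ over $\Bbbk$, i.e. a monoid homomorphism $\rho\colon\mathcal{H}_n\to\operatorname{End}_{\Bbbk}(V)$ for a $\Bbbk$-vector space $V$, is called effective if $\rho$ is injective; its degree is $\dim_{\Bbbk}V$. Then the minimal degree of an effective linear representation of $\mathcal{H}_n$ over $\Bbbk$ is $2^n-n-1$: there is an effective representation of this degree, and every effective representation has at least this degree. -/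

import Mathlib

universe u v

/-- The defining relations of the type `A` `0`-Hecke monoid on letters `e₁, …, e_{n-1}`; the letter
`e_{i+1}` is the free generator indexed by `i : Fin (n - 1)`. -/
inductive ZeroHeckeRel (n : ℕ) : FreeMonoid (Fin (n - 1)) → FreeMonoid (Fin (n - 1)) → Prop
  | idem (i : Fin (n - 1)) :
      ZeroHeckeRel n (FreeMonoid.of i * FreeMonoid.of i) (FreeMonoid.of i)
  | comm (i j : Fin (n - 1)) (hij : (i : ℕ) ≠ (j : ℕ) + 1) (hji : (j : ℕ) ≠ (i : ℕ) + 1) :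
      ZeroHeckeRel n (FreeMonoid.of i * FreeMonoid.of j) (FreeMonoid.of j * FreeMonoid.of i)
  | braid (i j : Fin (n - 1)) (hij : (j : ℕ) = (i : ℕ) + 1) :
      ZeroHeckeRel n (FreeMonoid.of i * FreeMonoid.of j * FreeMonoid.of i)
        (FreeMonoid.of j * FreeMonoid.of i * FreeMonoid.of j)

/-- The `0`-Hecke monoid `𝓗ₙ` of the symmetric group `Sₙ`, as a presented monoid. -/
abbrev ZeroHeckeMonoid (n : ℕ) : Type := PresentedMonoid (ZeroHeckeRel n)

/-- A linear representation of a monoid is effective if distinct elements of the monoid act by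
distinct operators. This does not ask the monoid algebra to act faithfully. -/
def Representation.IsEffective {k M V : Type*} [Field k] [Monoid M] [AddCommGroup V] [Module k V]
    (ρ : Representation k M V) : Prop :=
  Function.Injective ρ

/-- The dimensions, finite or infinite, of the effective linear representations over `k` of the
monoid `M`. -/
def effectiveDimensions (k : Type u) [Field k] (M : Type) [Monoid M] : Set Cardinal.{max u v} :=
  {d | ∃ (V : Type (max u v)) (_ : AddCommGroup V) (_ : Module k V) (ρ : Representation k M V),
    ρ.IsEffective ∧ Module.rank k V = d}

/-! Let the `i`-th generator sort positions `i`, `i + 1` of a word. This respects the defining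
relations, and a normal form shows that the decreasing word of length `n` has trivial stabilizer
behaviour: its image determines the acting element. Its orbit consists of all permutations.

Upper bound: thresholding a permutation gives binary words, and all thresholds together recover it
(the 0-1 principle), so the action on binary words of length `n` is effective. Sorted words are
fixed points, one for each number of letters `false`, and sorting preserves that number; hence they
can be killed without losing information. The `2^n - (n + 1)` unsorted words remain as a basis.

Lower bound: every effective `ρ` contains this module. Standardizing a binary word `l` gives a
permutation, hence a monoid element `w_l`, and left multiplication by generators sorts `l`. With a
vector `v_c` for each number `c` of letters `false`, the map `l ↦ ρ(w_l) v_c - ρ(w_sorted) v_c` is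
equivariant and kills sorted words. Sorting lowers words lexicographically, so the action is
triangular and a nonzero kernel would contain a common eigenvector of the generators with
eigenvalues 0 and 1. Such eigenvectors are multiples of words `0…0 1 0 1…1`, at most one for each
`c`, so effectiveness allows `v_c` to be chosen with nonzero image there. The map is therefore
injective. -/

section Bubble

/-! ### Operators that sort adjacent entries. -/

variable {α : Type*} [LinearOrder α]

/-- Sort the entries at positions `i` and `i + 1` of a list. -/
def bubble : ℕ → List α → List α
  | 0, a :: b :: l => min a b :: max a b :: l
  | i + 1, a :: l => a :: bubble i l
  | 0, [] => []
  | 0, [a] => [a]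
  | _ + 1, [] => []

@[simp] theorem bubble_nil (i : ℕ) : bubble i ([] : List α) = [] := by cases i <;> rfl

@[simp] theorem bubble_singleton (i : ℕ) (a : α) : bubble i [a] = [a] := by
  cases i <;> simp [bubble]

@[simp] theorem bubble_zero_cons_cons (a b : α) (l : List α) :
    bubble 0 (a :: b :: l) = min a b :: max a b :: l := rfl

@[simp] theorem bubble_succ_cons (i : ℕ) (a : α) (l : List α) :
    bubble (i + 1) (a :: l) = a :: bubble i l := rfl

theorem bubble_zero_of_le {a b : α} (h : a ≤ b) (l : List α) :
    bubble 0 (a :: b :: l) = a :: b :: l := by simp [h]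

theorem bubble_zero_of_ge {a b : α} (h : b ≤ a) (l : List α) :
    bubble 0 (a :: b :: l) = b :: a :: l := by simp [h]

theorem bubble_perm (i : ℕ) (l : List α) : (bubble i l).Perm l := by
  induction l generalizing i with
  | nil => simp
  | cons a l ih =>
    cases i with
    | succ i => exact (ih i).cons a
    | zero =>
      cases l with
      | nil => simp
      | cons b l =>
        rcases le_total a b with h | h
        · rw [bubble_zero_of_le h]
        · rw [bubble_zero_of_ge h]; exact List.Perm.swap _ _ _

@[simp] theorem length_bubble (i : ℕ) (l : List α) : (bubble i l).length = l.length :=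
  (bubble_perm i l).length_eq

theorem bubble_idem (i : ℕ) (l : List α) : bubble i (bubble i l) = bubble i l := by
  induction l generalizing i with
  | nil => simp
  | cons a l ih =>
    cases i with
    | succ i => simp [ih]
    | zero => cases l <;> simp

theorem bubble_comm_zero (j : ℕ) (l : List α) :
    bubble 0 (bubble (j + 2) l) = bubble (j + 2) (bubble 0 l) := by
  match l with
  | [] => simp
  | [a] => simp
  | a :: b :: l => simp

theorem bubble_comm {i j : ℕ} (hij : i ≠ j + 1) (hji : j ≠ i + 1) (l : List α) :
    bubble i (bubble j l) = bubble j (bubble i l) := by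
  induction l generalizing i j with
  | nil => simp
  | cons a l ih =>
    match i, j with
    | 0, 0 => rfl
    | 0, 1 => omega
    | 1, 0 => omega
    | 0, j + 2 => exact bubble_comm_zero j _
    | i + 2, 0 => exact (bubble_comm_zero i _).symm
    | i + 1, j + 1 => simp [ih (i := i) (j := j) (by omega) (by omega)]

theorem bubble_braid (i : ℕ) (l : List α) :
    bubble i (bubble (i + 1) (bubble i l)) = bubble (i + 1) (bubble i (bubble (i + 1) l)) := by
  induction l generalizing i with
  | nil => simp
  | cons a l ih =>
    cases i with
    | succ i => simpa using ih i
    | zero =>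
      match l with
      | [] => simp
      | [b] => simp
      | b :: c :: l =>
        rcases le_total a b with h | h <;> rcases le_total b c with h' | h' <;>
          rcases le_total a c with h'' | h'' <;> simp [*] <;> grind

theorem map_bubble {β : Type*} [LinearOrder β] {f : α → β} (hf : Monotone f) (i : ℕ)
    (l : List α) : (bubble i l).map f = bubble i (l.map f) := by
  induction l generalizing i with
  | nil => simp
  | cons a l ih =>
    cases i with
    | succ i => simp [ih]
    | zero => cases l <;> simp [hf.map_min, hf.map_max]

theorem pairwise_le_iff_bubble (l : List α) :
    l.Pairwise (· ≤ ·) ↔ ∀ i, i + 1 < l.length → bubble i l = l := by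
  rw [← List.isChain_iff_pairwise]
  induction l with
  | nil => simp
  | cons a l ih =>
    cases l with
    | nil => simp
    | cons b l =>
      rw [List.isChain_cons_cons, ih]
      constructor
      · rintro ⟨h, h'⟩ i hi
        cases i with
        | zero => exact bubble_zero_of_le h l
        | succ i => simpa using h' i (by simpa using hi)
      · intro h
        refine ⟨by simpa using h 0 (by simp), fun i hi => ?_⟩
        simpa using h (i + 1) (by simpa using hi)

end Bubble

/-! ### The action of the monoid on lists. -/

section Action

variable {α : Type*} [LinearOrder α] {n : ℕ}

/-- The action of the `0`-Hecke monoid on lists, in which the generators sort adjacent entries. -/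
def heckeAction (n : ℕ) (α : Type*) [LinearOrder α] :
    ZeroHeckeMonoid n →* Function.End (List α) :=
  PresentedMonoid.lift (M := Function.End (List α))
    (fun i : Fin (n - 1) => (bubble (i : ℕ) : Function.End (List α))) (by
    intro a b h
    cases h with
    | idem i => funext l; exact bubble_idem _ l
    | comm i j hij hji => funext l; exact bubble_comm hij hji l
    | braid i j hij =>
      funext l
      have := bubble_braid (i : ℕ) l
      rw [← hij] at this
      exact this)

/-- The generators of the `0`-Hecke monoid. -/
def heckeGen (i : Fin (n - 1)) : ZeroHeckeMonoid n := PresentedMonoid.of _ i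

instance : MulAction (ZeroHeckeMonoid n) (List α) where
  smul h l := heckeAction n α h l
  one_smul l := by
    change heckeAction n α 1 l = l
    rw [map_one]; rfl
  mul_smul g h l := by
    change heckeAction n α (g * h) l = heckeAction n α g (heckeAction n α h l)
    rw [map_mul]; rfl

@[simp] theorem heckeGen_smul (i : Fin (n - 1)) (l : List α) :
    heckeGen i • l = bubble (i : ℕ) l := rfl

theorem hecke_induction {p : ZeroHeckeMonoid n → Prop} (one : p 1)
    (gen_mul : ∀ i h, p h → p (heckeGen i * h)) (h : ZeroHeckeMonoid n) : p h := by
  have hc : h ∈ Submonoid.closure (Set.range (PresentedMonoid.of (ZeroHeckeRel n))) := by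
    rw [PresentedMonoid.closure_range_of]; trivial
  induction hc using Submonoid.closure_induction_left with
  | one => exact one
  | mul_left x hx y hy ih =>
    obtain ⟨i, rfl⟩ := hx
    exact gen_mul i y ih

theorem heckeGen_idem (i : Fin (n - 1)) : heckeGen i * heckeGen i = heckeGen i :=
  (conGen (ZeroHeckeRel n)).eq.2 (ConGen.Rel.of _ _ (ZeroHeckeRel.idem i))

theorem heckeGen_comm (i j : Fin (n - 1)) (hij : (i : ℕ) ≠ (j : ℕ) + 1)
    (hji : (j : ℕ) ≠ (i : ℕ) + 1) : heckeGen i * heckeGen j = heckeGen j * heckeGen i :=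
  (conGen (ZeroHeckeRel n)).eq.2 (ConGen.Rel.of _ _ (ZeroHeckeRel.comm i j hij hji))

theorem heckeGen_braid (i j : Fin (n - 1)) (hij : (j : ℕ) = (i : ℕ) + 1) :
    heckeGen i * heckeGen j * heckeGen i = heckeGen j * heckeGen i * heckeGen j :=
  (conGen (ZeroHeckeRel n)).eq.2 (ConGen.Rel.of _ _ (ZeroHeckeRel.braid i j hij))

theorem smul_perm (h : ZeroHeckeMonoid n) (l : List α) : (h • l).Perm l := by
  induction h using hecke_induction with
  | one => simp
  | gen_mul i h ih => rw [mul_smul, heckeGen_smul]; exact (bubble_perm _ _).trans ih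

theorem map_smul_list {β : Type*} [LinearOrder β] {f : α → β} (hf : Monotone f)
    (h : ZeroHeckeMonoid n) (l : List α) : (h • l).map f = h • l.map f := by
  induction h using hecke_induction with
  | one => simp
  | gen_mul i h ih => rw [mul_smul, mul_smul, heckeGen_smul, heckeGen_smul, map_bubble hf, ih]

theorem smul_eq_self_of_sorted (h : ZeroHeckeMonoid n) {l : List α} (hl : l.length = n)
    (hs : l.Pairwise (· ≤ ·)) : h • l = l := by
  induction h using hecke_induction with
  | one => simp
  | gen_mul i h ih =>
    rw [mul_smul, ih, heckeGen_smul]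
    exact (pairwise_le_iff_bubble l).1 hs i (by omega)

end Action

/-! ### Normal forms: an element is recovered from its effect on the decreasing word. -/

section NormalForm

variable {n : ℕ}

/-- The generators of the `0`-Hecke monoid indexed by all natural numbers, with an external zero
as the value out of range. -/
def heckeGenZero (n i : ℕ) : WithZero (ZeroHeckeMonoid n) :=
  if h : i < n - 1 then (heckeGen ⟨i, h⟩ : ZeroHeckeMonoid n) else 0

theorem heckeGenZero_coe (i : Fin (n - 1)) :
    heckeGenZero n i = (heckeGen i : ZeroHeckeMonoid n) := by simp [heckeGenZero]

/-- With zero as the out-of-range value, the relations hold for all natural indices and the word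
calculus needs no bounds. -/
theorem heckeGenZero_idem (i : ℕ) :
    heckeGenZero n i * heckeGenZero n i = heckeGenZero n i := by
  unfold heckeGenZero
  split_ifs with h
  · rw [← WithZero.coe_mul, heckeGen_idem]
  · simp

theorem heckeGenZero_comm {i j : ℕ} (h : i + 1 < j) :
    heckeGenZero n i * heckeGenZero n j = heckeGenZero n j * heckeGenZero n i := by
  unfold heckeGenZero
  split_ifs
  · rw [← WithZero.coe_mul, ← WithZero.coe_mul, heckeGen_comm _ _ (by simp; omega) (by simp; omega)]
  all_goals simp

theorem heckeGenZero_braid (i : ℕ) :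
    heckeGenZero n i * heckeGenZero n (i + 1) * heckeGenZero n i =
      heckeGenZero n (i + 1) * heckeGenZero n i * heckeGenZero n (i + 1) := by
  unfold heckeGenZero
  split_ifs
  · simp only [← WithZero.coe_mul]
    rw [heckeGen_braid _ _ rfl]
  all_goals simp

/-- The product of the `q` consecutive generators that start at index `d`. -/
def heckeRun (n : ℕ) : ℕ → ℕ → WithZero (ZeroHeckeMonoid n)
  | _, 0 => 1
  | d, q + 1 => heckeGenZero n d * heckeRun n (d + 1) q

theorem heckeGenZero_comm_run {i d : ℕ} (h : i + 1 < d) (q : ℕ) :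
    heckeGenZero n i * heckeRun n d q = heckeRun n d q * heckeGenZero n i := by
  induction q generalizing d with
  | zero => simp [heckeRun]
  | succ q ih =>
    rw [heckeRun, ← mul_assoc, heckeGenZero_comm h, mul_assoc, ih (by omega), mul_assoc]

theorem heckeRun_mul_gen {d j : ℕ} (q : ℕ) (h : d ≤ j) (hj : j + 1 < d + q) :
    heckeRun n d q * heckeGenZero n j = heckeGenZero n (j + 1) * heckeRun n d q := by
  induction q generalizing d with
  | zero => omega
  | succ q ih =>
    rcases h.eq_or_lt with rfl | h
    · obtain ⟨q, rfl⟩ : ∃ p, q = p + 1 := ⟨q - 1, by omega⟩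
      simp only [heckeRun]
      rw [mul_assoc, mul_assoc, ← heckeGenZero_comm_run (by omega)]
      simp only [← mul_assoc]
      rw [heckeGenZero_braid]
    · rw [heckeRun, mul_assoc, ih h (by omega), ← mul_assoc, heckeGenZero_comm (by omega),
        mul_assoc]

theorem heckeRun_mul_run {d e m : ℕ} (q : ℕ) (h : d ≤ e) (hq : e + q < d + m) :
    heckeRun n d m * heckeRun n e q = heckeRun n (e + 1) q * heckeRun n d m := by
  induction q generalizing e with
  | zero => simp [heckeRun]
  | succ q ih =>
    rw [heckeRun, ← mul_assoc, heckeRun_mul_gen m h (by omega), mul_assoc,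
      ih (by omega) (by omega), ← mul_assoc]
    rfl

/-- The element of the `0`-Hecke monoid that turns the decreasing rearrangement of a list without
repetitions into the list; the list is thought of as starting at position `d`. -/
def heckeWord (n : ℕ) : ℕ → List ℕ → WithZero (ZeroHeckeMonoid n)
  | _, [] => 1
  | d, a :: l => heckeWord n (d + 1) l * heckeRun n d (l.countP (a < ·))

theorem heckeGenZero_comm_word {i d : ℕ} (h : i + 1 < d) (l : List ℕ) :
    heckeGenZero n i * heckeWord n d l = heckeWord n d l * heckeGenZero n i := by
  induction l generalizing d with
  | nil => simp [heckeWord]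
  | cons a l ih =>
    rw [heckeWord, ← mul_assoc, ih (by omega), mul_assoc, heckeGenZero_comm_run h, mul_assoc]

/-- At the head, two runs meet. If the first two entries ascend, exchanging the runs puts the one
starting with generator `d` in front, which absorbs that generator; if they descend, the generator
lengthens the shorter-indexed run and the same exchange gives the swapped word. -/
theorem heckeWord_bubble (i d : ℕ) (l : List ℕ) (hl : l.Nodup) (hi : i + 1 < l.length) :
    heckeWord n d (bubble i l) = heckeGenZero n (d + i) * heckeWord n d l := by
  induction l generalizing i d with
  | nil => simp at hi
  | cons a l ih =>
    cases i with
    | succ i =>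
      rw [bubble_succ_cons, heckeWord, ih i (d + 1) (List.nodup_cons.1 hl).2 (by simpa using hi),
        (bubble_perm i l).countP_eq, heckeWord, mul_assoc, Nat.add_right_comm d 1 i]
      rfl
    | zero =>
      match l with
      | [] => simp at hi
      | b :: l =>
        have hab : a ≠ b := by rintro rfl; simp at hl
        have key : ∀ p q : ℕ, p ≤ q →
            heckeRun n (d + 1) p * heckeRun n d (q + 1) =
              heckeRun n d (q + 1) * heckeRun n d p := fun p q h =>
          (heckeRun_mul_run p le_rfl (by omega)).symm
        have idem : ∀ q, heckeGenZero n d * heckeRun n d (q + 1) = heckeRun n d (q + 1) := by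
          intro q
          rw [heckeRun, ← mul_assoc, heckeGenZero_idem]
        have comm := heckeGenZero_comm_word (n := n) (i := d) (d := d + 1 + 1) (by omega) l
        have mono : ∀ x y : ℕ, x ≤ y → l.countP (y < ·) ≤ l.countP (x < ·) := fun x y h =>
          List.countP_mono_left (by simp; omega)
        rcases lt_or_gt_of_ne hab with h | h
        · rw [bubble_zero_of_le h.le]
          simp only [heckeWord, List.countP_cons, decide_eq_true h, if_true, add_zero]
          rw [mul_assoc, key _ _ (mono _ _ h.le), ← mul_assoc, ← mul_assoc (heckeGenZero n d),
            ← mul_assoc (heckeGenZero n d), comm, mul_assoc _ (heckeGenZero n d), idem]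
        · rw [bubble_zero_of_ge h.le]
          simp only [heckeWord, List.countP_cons, decide_eq_true h, if_true, add_zero,
            decide_eq_false h.not_gt, Bool.false_eq_true, if_false]
          rw [← mul_assoc, ← mul_assoc (heckeGenZero n d), comm,
            mul_assoc (heckeWord n _ l), key _ _ (mono _ _ h.le)]
          simp only [heckeRun, mul_assoc]

/-- The decreasing list `[n - 1, …, 1, 0]`. -/
abbrev revRange (n : ℕ) : List ℕ := (List.range n).reverse

theorem heckeWord_of_decreasing (d : ℕ) {l : List ℕ} (hl : l.Pairwise (· ≥ ·)) :
    heckeWord n d l = 1 := by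
  induction l generalizing d with
  | nil => rfl
  | cons a l ih =>
    rw [List.pairwise_cons] at hl
    have : l.countP (a < ·) = 0 := by
      rw [List.countP_eq_zero]; simpa using hl.1
    rw [heckeWord, ih _ hl.2, this]; simp [heckeRun]

theorem pairwise_revRange (n : ℕ) : (revRange n).Pairwise (· ≥ ·) := by
  rw [List.pairwise_reverse]
  exact List.pairwise_le_range

theorem nodup_revRange (n : ℕ) : (revRange n).Nodup := List.nodup_reverse.2 List.nodup_range

theorem heckeWord_smul (h : ZeroHeckeMonoid n) : heckeWord n 0 (h • revRange n) = h := by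
  induction h using hecke_induction with
  | one => rw [one_smul, heckeWord_of_decreasing 0 (pairwise_revRange n)]; rfl
  | gen_mul i h ih =>
    have hp := smul_perm h (revRange n)
    rw [mul_smul, heckeGen_smul, heckeWord_bubble _ _ _ (hp.nodup_iff.2 (nodup_revRange n)) (by
      rw [hp.length_eq]; simp; omega), ih, WithZero.coe_mul, zero_add, heckeGenZero_coe]

theorem smul_revRange_injective :
    Function.Injective fun h : ZeroHeckeMonoid n => h • revRange n := by
  intro g h hgh
  have := congrArg (heckeWord n 0) hgh
  simpa only [heckeWord_smul, WithZero.coe_inj] using this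

end NormalForm

/-! ### The orbit of the decreasing word is all permutations. -/

section Reachability

variable {n : ℕ}

/-- A list is reachable from another one by sorting adjacent entries. -/
def BubbleReach : List ℕ → List ℕ → Prop :=
  Relation.ReflTransGen fun l l' => ∃ i, i + 1 < l.length ∧ l' = bubble i l

theorem BubbleReach.cons {l l' : List ℕ} (h : BubbleReach l l') (a : ℕ) :
    BubbleReach (a :: l) (a :: l') := by
  induction h with
  | refl => exact Relation.ReflTransGen.refl
  | tail _ h' ih =>
    obtain ⟨i, hi, rfl⟩ := h'
    exact ih.tail ⟨i + 1, by simpa using hi, rfl⟩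

/-- Insertion into a decreasing list played backwards: `a` returns to the front past larger entries,
and each such swap is a sorting step. -/
theorem bubbleReach_orderedInsert (a : ℕ) (l : List ℕ) :
    BubbleReach (l.orderedInsert (· ≥ ·) a) (a :: l) := by
  induction l with
  | nil => exact Relation.ReflTransGen.refl
  | cons b l ih =>
    rw [List.orderedInsert_cons]
    split_ifs with h
    · exact Relation.ReflTransGen.refl
    · exact (ih.cons b).tail ⟨0, by simp, (bubble_zero_of_ge (not_le.1 h).le l).symm⟩

theorem bubbleReach_insertionSort (l : List ℕ) : BubbleReach (l.insertionSort (· ≥ ·)) l := by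
  induction l with
  | nil => exact Relation.ReflTransGen.refl
  | cons a l ih => exact (bubbleReach_orderedInsert a _).trans (ih.cons a)

theorem BubbleReach.exists_smul {l l' : List ℕ} (h : BubbleReach l l') (hl : l.length = n) :
    ∃ g : ZeroHeckeMonoid n, g • l = l' := by
  induction h with
  | refl => exact ⟨1, one_smul _ _⟩
  | tail _ h' ih =>
    obtain ⟨g, rfl⟩ := ih
    obtain ⟨i, hi, rfl⟩ := h'
    rw [(smul_perm g l).length_eq] at hi
    exact ⟨heckeGen ⟨i, by omega⟩ * g, by rw [mul_smul, heckeGen_smul]⟩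

theorem exists_smul_revRange {l : List ℕ} (hl : l.Perm (List.range n)) :
    ∃ g : ZeroHeckeMonoid n, g • revRange n = l := by
  refine BubbleReach.exists_smul ?_ (by simp)
  have : revRange n = l.insertionSort (· ≥ ·) :=
    List.Perm.eq_of_pairwise' (pairwise_revRange n) (List.pairwise_insertionSort _ l)
      ((List.reverse_perm _).trans (hl.symm.trans (List.perm_insertionSort _ l).symm))
  rw [this]
  exact bubbleReach_insertionSort l

end Reachability

/-! ### Binary words as elements of the monoid. -/

section Standardize

variable {n : ℕ}

/-- Replace the entries `false` by `z, z + 1, …` and the entries `true` by `o, o + 1, …`. -/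
def standardize : ℕ → ℕ → List Bool → List ℕ
  | _, _, [] => []
  | z, o, false :: l => z :: standardize (z + 1) o l
  | z, o, true :: l => o :: standardize z (o + 1) l

/-- Labels of `false` stay below labels of `true`, and equal letters are labelled in increasing
order, so exactly the descents of `l` are swapped. -/
theorem bubble_standardize (i z o : ℕ) (l : List Bool) (h : z + l.count false ≤ o) :
    bubble i (standardize z o l) = standardize z o (bubble i l) := by
  induction l generalizing i z o with
  | nil => simp [standardize]
  | cons a l ih =>
    cases i with
    | succ i =>
      cases a
      · simp only [List.count_cons_self] at h
        simp [standardize, ih i (z + 1) o (by omega)]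
      · simp only [List.count_cons] at h
        simp [standardize, ih i z (o + 1) (by simp at h; omega)]
    | zero =>
      match l with
      | [] => cases a <;> simp [standardize]
      | b :: l =>
        cases a <;> cases b <;> simp [standardize] at h ⊢ <;> omega

theorem standardize_perm (z o : ℕ) (l : List Bool) :
    (standardize z o l).Perm
      (List.range' z (l.count false) ++ List.range' o (l.count true)) := by
  induction l generalizing z o with
  | nil => simp [standardize]
  | cons a l ih =>
    cases a
    · simpa [standardize, List.range'_succ] using ih (z + 1) o
    · simp only [standardize, List.count_cons_self, List.range'_succ]
      simp only [List.count_cons, reduceCtorEq, beq_iff_eq, if_false, add_zero]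
      exact ((ih z (o + 1)).cons o).trans List.perm_middle.symm

theorem standardize_injective (z o : ℕ) (l l' : List Bool) (h : z + l.count false ≤ o)
    (h' : z + l'.count false ≤ o) (heq : standardize z o l = standardize z o l') : l = l' := by
  induction l generalizing l' z o with
  | nil =>
    match l' with
    | [] => rfl
    | false :: l => simp [standardize] at heq
    | true :: l => simp [standardize] at heq
  | cons a l ih =>
    match l' with
    | [] => cases a <;> simp [standardize] at heq
    | b :: l' =>
      cases a <;> cases b <;> simp [standardize] at heq h h' ⊢
      · exact ih _ _ _ (by omega) (by omega) heq
      · omega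
      · omega
      · exact ih _ _ _ (by omega) (by omega) heq

/-- The standardization of a binary word. -/
abbrev standardization (l : List Bool) : List ℕ := standardize 0 (l.count false) l

theorem exists_smul_revRange_eq_standardization (l : List Bool) (hl : l.length = n) :
    ∃ g : ZeroHeckeMonoid n, g • revRange n = standardization l := by
  apply exists_smul_revRange
  have h := standardize_perm 0 (l.count false) l
  have e := List.count_false_add_count_true l
  have e' := List.range'_append (s := 0) (m := l.count false) (n := l.count true) (step := 1)
  simp only [zero_add, one_mul] at e'
  rw [e', e, hl, ← List.range_eq_range'] at h
  exact h

/-- The element of the `0`-Hecke monoid that sends the decreasing word to the standardization of a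
binary word of length `n`. -/
noncomputable def wordElement (n : ℕ) (l : List Bool) : ZeroHeckeMonoid n :=
  if h : l.length = n then (exists_smul_revRange_eq_standardization l h).choose else 1

theorem wordElement_smul {l : List Bool} (hl : l.length = n) :
    wordElement n l • revRange n = standardization l := by
  rw [wordElement, dif_pos hl]
  exact (exists_smul_revRange_eq_standardization l hl).choose_spec

theorem heckeGen_mul_wordElement (i : Fin (n - 1)) {l : List Bool} (hl : l.length = n) :
    heckeGen i * wordElement n l = wordElement n (bubble i l) := by
  apply smul_revRange_injective
  simp only
  rw [mul_smul, wordElement_smul hl, wordElement_smul (by simpa using hl), heckeGen_smul,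
    bubble_standardize _ _ _ _ (by simp)]
  change _ = standardize 0 ((bubble (i : ℕ) l).count false) _
  rw [(bubble_perm _ l).count_eq]

/-- Equal counts are essential: all sorted words of length `n` standardize to the same increasing
list. -/
theorem wordElement_injective {l l' : List Bool} (hl : l.length = n) (hl' : l'.length = n)
    (hc : l.count false = l'.count false) (h : wordElement n l = wordElement n l') : l = l' := by
  have := congrArg (· • revRange n) h
  simp only [wordElement_smul hl, wordElement_smul hl', standardization] at this
  rw [← hc] at this
  exact standardize_injective _ _ _ _ (by simp) (by simp [hc]) this

end Standardize

/-! ### Binary words: lexicographic order, near-sorted words, counting. -/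

section BinaryWords

variable {n : ℕ}

theorem eq_of_bubble_eq {α : Type*} [LinearOrder α] {i : ℕ} {l l' : List α}
    (h : bubble i l = bubble i l') (hl : bubble i l ≠ l) (hl' : bubble i l' ≠ l') : l = l' := by
  induction l generalizing i l' with
  | nil => simp at hl
  | cons a l ih =>
    match i, l, l' with
    | _, _, [] => simp at hl'
    | i + 1, l, b :: l' =>
      simp only [bubble_succ_cons, List.cons.injEq, ne_eq, true_and] at h hl hl'
      rw [h.1, ih h.2 hl hl']
    | 0, [], _ => simp at hl
    | 0, _, [_] => simp at hl'
    | 0, b :: l, c :: d :: l' =>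
      have hab : b ≤ a := by
        by_contra hc
        exact hl (bubble_zero_of_le (not_le.1 hc).le l)
      have hcd : d ≤ c := by
        by_contra hc
        exact hl' (bubble_zero_of_le (not_le.1 hc).le l')
      rw [bubble_zero_of_ge hab, bubble_zero_of_ge hcd] at h
      simp_all

theorem bubble_le {α : Type*} [LinearOrder α] (i : ℕ) (l : List α) : bubble i l ≤ l := by
  induction l generalizing i with
  | nil => simp
  | cons a l ih =>
    match i, l with
    | i + 1, l =>
      rw [bubble_succ_cons]
      rcases (ih i).eq_or_lt with h | h
      · rw [h]
      · exact (List.cons_lt_cons_iff.2 (Or.inr ⟨rfl, h⟩)).le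
    | 0, [] => simp
    | 0, b :: l =>
      rcases le_or_gt a b with h | h
      · rw [bubble_zero_of_le h]
      · rw [bubble_zero_of_ge h.le]
        exact (List.cons_lt_cons_iff.2 (Or.inl h)).le

theorem bubble_lt_bubble {i : ℕ} {b a : List Bool} (hb : bubble i b ≠ b)
    (hlen : b.length = a.length) (h : b < a) : bubble i b < bubble i a := by
  induction b generalizing i a with
  | nil => simp at hb
  | cons x b ih =>
    match i, b, a with
    | _, _, [] => simp at hlen
    | i + 1, b, y :: a =>
      simp only [bubble_succ_cons, List.cons.injEq, ne_eq, true_and] at hb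
      rw [bubble_succ_cons, bubble_succ_cons]
      rw [List.cons_lt_cons_iff] at h ⊢
      exact h.imp id fun h => ⟨h.1, ih hb (by simpa using hlen) h.2⟩
    | 0, [], _ => simp at hb
    | 0, _ :: _, [_] => simp at hlen
    | 0, x' :: b, y :: y' :: a =>
      simp only [bubble_zero_cons_cons] at hb ⊢
      simp only [List.cons_lt_cons_iff] at h ⊢
      revert hb h
      cases x <;> cases x' <;> cases y <;> cases y' <;> simp

theorem eq_of_sorted_of_count {l l' : List Bool} (hs : l.Pairwise (· ≤ ·))
    (hs' : l'.Pairwise (· ≤ ·)) (hlen : l.length = l'.length)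
    (hc : l.count false = l'.count false) : l = l' := by
  refine List.Perm.eq_of_pairwise' hs hs' (List.perm_iff_count.2 fun b => ?_)
  have h := List.count_false_add_count_true l
  have h' := List.count_false_add_count_true l'
  cases b <;> omega

theorem eq_of_bubble_sorted {i : ℕ} {l : List Bool} (hl : ¬ l.Pairwise (· ≤ ·))
    (h : (bubble i l).Pairwise (· ≤ ·)) :
    l = List.replicate i false ++ true :: false :: List.replicate (l.length - (i + 2)) true := by
  induction l generalizing i with
  | nil => simp at hl
  | cons a l ih =>
    match i, l with
    | 0, [] => simp at hl
    | 0, b :: l =>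
      have hab : b < a := by
        by_contra hc
        rw [bubble_zero_of_le (not_lt.1 hc)] at h
        exact hl h
      rw [bubble_zero_of_ge hab.le] at h
      have hb : b = false ∧ a = true := by revert hab; cases a <;> cases b <;> simp
      obtain ⟨rfl, rfl⟩ := hb
      simp only [List.replicate_zero, List.nil_append, List.cons.injEq, true_and]
      rw [List.eq_replicate_iff]
      refine ⟨by simp, fun c hc => ?_⟩
      have := (List.pairwise_cons.1 (List.pairwise_cons.1 h).2).1 c hc
      revert this; cases c <;> simp
    | i + 1, l =>
      rw [bubble_succ_cons, List.pairwise_cons] at h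
      have hmem : ∀ c ∈ l, a ≤ c := fun c hc => h.1 c ((bubble_perm i l).mem_iff.2 hc)
      have hl' : ¬ l.Pairwise (· ≤ ·) := fun hs => hl (List.pairwise_cons.2 ⟨hmem, hs⟩)
      cases a
      · rw [List.replicate_succ, List.cons_append, List.cons_inj_right]
        refine (ih hl' h.2).trans ?_
        congr 4
        simp
      · refine absurd (List.pairwise_of_forall_mem_list fun x _ y hy => ?_) hl'
        have := hmem y hy
        revert this; cases y <;> simp

theorem count_of_bubble_sorted {i : ℕ} {l : List Bool} (hl : ¬ l.Pairwise (· ≤ ·))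
    (h : (bubble i l).Pairwise (· ≤ ·)) : l.count false = i + 1 := by
  rw [eq_of_bubble_sorted hl h]
  simp [List.count_replicate]

/-- The binary words of length `n` that are not sorted. -/
def unsortedWords (n : ℕ) : Set (List Bool) := {l | l.length = n ∧ ¬ l.Pairwise (· ≤ ·)}

theorem mem_unsortedWords_of_smul (h : ZeroHeckeMonoid n) (l : List Bool)
    (hl : h • l ∈ unsortedWords n) : l ∈ unsortedWords n := by
  have hlen : l.length = n := (smul_perm h l).length_eq.symm.trans hl.1
  refine ⟨hlen, fun hs => hl.2 ?_⟩
  rwa [smul_eq_self_of_sorted h hlen hs]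

instance : Finite {l : List Bool // l.length = n} :=
  inferInstanceAs (Finite (List.Vector Bool n))

instance : Finite (unsortedWords n) :=
  Finite.of_injective (β := {l : List Bool // l.length = n}) (fun l => ⟨l.1, l.2.1⟩)
    fun _ _ h => Subtype.ext (Subtype.mk.inj h)

theorem exists_bubble_ne {l : List Bool} (hl : l ∈ unsortedWords n) :
    ∃ i : Fin (n - 1), bubble (i : ℕ) l ≠ l := by
  by_contra! hc
  refine hl.2 ((pairwise_le_iff_bubble l).2 fun i hi => hc ⟨i, ?_⟩)
  have := hl.1
  omega

/-- Sort `b` greedily, always at a descent of the current word. By `bubble_lt_bubble` a larger word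
stays strictly larger at every step, so it cannot end at the sorted word of the same level. -/
theorem exists_smul_sorted_le (b : {l : List Bool // l.length = n}) :
    ∃ x : ZeroHeckeMonoid n, (x • b.1).Pairwise (· ≤ ·) ∧
      ∀ a : List Bool, a.length = n → a.count false = b.1.count false →
        (x • a).Pairwise (· ≤ ·) → a ≤ b.1 := by
  induction b using WellFoundedLT.induction with
  | ind b ih =>
    by_cases hs : b.1.Pairwise (· ≤ ·)
    · refine ⟨1, by simpa using hs, fun a ha hc h => ?_⟩
      rw [one_smul] at h
      rw [eq_of_sorted_of_count h hs (ha.trans b.2.symm) hc]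
    · obtain ⟨i, hi⟩ := exists_bubble_ne (n := n) ⟨b.2, hs⟩
      obtain ⟨x, hx, hx'⟩ := ih ⟨bubble i b.1, by simpa using b.2⟩ ((bubble_le _ _).lt_of_ne hi)
      refine ⟨x * heckeGen i, by simpa [mul_smul] using hx, fun a ha hc h => ?_⟩
      rw [mul_smul, heckeGen_smul] at h
      by_contra hba
      refine (hx' _ (by simpa using ha) ?_ h).not_gt
        (bubble_lt_bubble hi (b.2.trans ha.symm) (not_le.1 hba))
      rw [(bubble_perm _ _).count_eq, (bubble_perm _ _).count_eq, hc]

/-- The sorted rearrangement of a binary word. -/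
abbrev sortedWord (l : List Bool) : List Bool := l.insertionSort (· ≤ ·)

theorem sortedWord_eq_of_perm {l l' : List Bool} (h : l.Perm l') : sortedWord l = sortedWord l' :=
  List.Perm.eq_of_pairwise' (List.pairwise_insertionSort _ _) (List.pairwise_insertionSort _ _)
    ((List.perm_insertionSort _ _).trans (h.trans (List.perm_insertionSort _ _).symm))

theorem card_unsortedWords (n : ℕ) : Nat.card (unsortedWords n) = 2 ^ n - n - 1 := by
  classical
  let U : Set {l : List Bool // l.length = n} := {l | ¬ l.1.Pairwise (· ≤ ·)}
  have e : unsortedWords n ≃ U :=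
    { toFun := fun l => ⟨⟨l.1, l.2.1⟩, l.2.2⟩
      invFun := fun l => ⟨l.1.1, l.1.2, l.2⟩
      left_inv := fun _ => rfl
      right_inv := fun _ => rfl }
  have hV : Nat.card {l : List Bool // l.length = n} = 2 ^ n := by
    change Nat.card (List.Vector Bool n) = _
    rw [Nat.card_eq_fintype_card, card_vector, Fintype.card_bool]
  have hS : Nat.card (Uᶜ : Set _) = n + 1 := by
    rw [← Nat.card_fin (n + 1)]
    symm
    refine Nat.card_eq_of_bijective (fun c : Fin (n + 1) =>
      (⟨⟨List.replicate c false ++ List.replicate (n - c) true, by simp; omega⟩, ?_⟩ :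
        (Uᶜ : Set {l : List Bool // l.length = n}))) ⟨?_, ?_⟩
    · simp only [U, Set.mem_compl_iff, Set.mem_ofPred_eq, not_not]
      rw [List.pairwise_append]
      refine ⟨by simp, by simp, fun a ha b hb => ?_⟩
      rw [List.eq_of_mem_replicate ha]
      exact Bool.false_le b
    · intro c c' h
      have := congrArg (fun l => l.1.1.count false) h
      simpa [List.count_replicate, Fin.ext_iff] using this
    · rintro ⟨⟨l, hl⟩, hs⟩
      simp only [U, Set.mem_compl_iff, Set.mem_ofPred_eq, not_not] at hs
      have hc : l.count false ≤ n := hl ▸ List.count_le_length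
      refine ⟨⟨l.count false, by omega⟩, ?_⟩
      refine Subtype.ext (Subtype.ext (eq_of_sorted_of_count ?_ hs ?_ ?_))
      · rw [List.pairwise_append]
        refine ⟨by simp, by simp, fun a ha b hb => ?_⟩
        rw [List.eq_of_mem_replicate ha]
        exact Bool.false_le b
      · simp; omega
      · simp [List.count_replicate]
  rw [Nat.card_congr e]
  have h1 := Set.ncard_add_ncard_compl U
  rw [hV] at h1
  change Set.ncard (Uᶜ) = n + 1 at hS
  change Set.ncard U = _
  omega

end BinaryWords

/-! ### Linearized actions with a set of sinks killed. -/

section SinkRep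

variable {k M X : Type*} [Field k] [Monoid M] [MulAction M X]

/-- The linearization of a monoid action, modulo the span of a subset closed under the action; it
has the complement `S` of that subset as a basis. -/
noncomputable def sinkRep (k : Type*) [Field k] {M X : Type*} [Monoid M] [MulAction M X]
    (S : Set X) (hS : ∀ (m : M) (x : X), m • x ∈ S → x ∈ S) : Representation k M (S →₀ k) := by
  classical
  exact
  { toFun := fun m => Finsupp.linearCombination k fun x : S =>
      if h : m • (x : X) ∈ S then Finsupp.single ⟨m • (x : X), h⟩ 1 else 0
    map_one' := by
      ext x : 2
      simp
    map_mul' := by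
      intro g h
      ext x : 2
      by_cases hx : h • (x : X) ∈ S
      · simp [hx, mul_smul]
      · have : ¬ g • h • (x : X) ∈ S := fun hc => hx (hS _ _ hc)
        simp [hx, mul_smul, this] }

variable {S : Set X} {hS : ∀ (m : M) (x : X), m • x ∈ S → x ∈ S}

theorem sinkRep_single_of_mem (m : M) (x : S) (c : k) (h : m • (x : X) ∈ S) :
    sinkRep k S hS m (Finsupp.single x c) = Finsupp.single ⟨m • (x : X), h⟩ c := by
  simp [sinkRep, h]

theorem sinkRep_single_of_notMem (m : M) (x : S) (c : k) (h : m • (x : X) ∉ S) :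
    sinkRep k S hS m (Finsupp.single x c) = 0 := by
  simp [sinkRep, h]

theorem linearCombination_sinkRep {V : Type*} [AddCommGroup V] [Module k V] (φ : X → V)
    (hφ : ∀ x ∉ S, φ x = 0) (m : M) (f : S →₀ k) :
    Finsupp.linearCombination k (fun x : S => φ x) (sinkRep k S hS m f) =
      Finsupp.linearCombination k (fun x : S => φ (m • (x : X))) f := by
  induction f using Finsupp.induction_linear with
  | zero => simp
  | add f g hf hg => simp [hf, hg]
  | single x c =>
    by_cases h : m • (x : X) ∈ S
    · simp [sinkRep_single_of_mem m x c h]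
    · simp [sinkRep_single_of_notMem m x c h, hφ _ h]

theorem sinkRep_apply [DecidableEq X] (m : M) (f : S →₀ k) (y : S) :
    sinkRep k S hS m f y =
      Finsupp.linearCombination k (fun x : S => if m • (x : X) = y then (1 : k) else 0) f := by
  rw [← linearCombination_sinkRep (hS := hS) (fun x : X => if x = y then (1 : k) else 0)]
  · rw [Finsupp.linearCombination_apply, Finsupp.sum]
    simp only [smul_eq_mul, mul_ite, mul_one, mul_zero, Subtype.coe_inj, Finset.sum_ite_eq',
      Finsupp.mem_support_iff]
    by_cases h : sinkRep k S hS m f y = 0 <;> simp [h]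
  · rintro x hx
    rw [if_neg]
    rintro rfl
    exact hx y.2

end SinkRep

/-! ### The effective representation on unsorted words. -/

section Upper

variable {n : ℕ}

/-- The 0-1 principle: thresholds are monotone, so they commute with sorting, and together they
determine every entry. -/
theorem eq_of_smul_binary_eq {g h : ZeroHeckeMonoid n}
    (hgh : ∀ l : List Bool, l.length = n → g • l = h • l) : g = h := by
  apply smul_revRange_injective
  have key : ∀ t : ℕ, (g • revRange n).map (fun x => decide (t ≤ x)) =
      (h • revRange n).map (fun x => decide (t ≤ x)) := by
    intro t
    have hm : Monotone fun x : ℕ => decide (t ≤ x) := by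
      intro x y hxy
      by_cases hx : t ≤ x
      · simp [hx, hx.trans hxy]
      · simp [hx]
    rw [map_smul_list hm, map_smul_list hm]
    exact hgh _ (by simp)
  have hlen : (g • revRange n).length = (h • revRange n).length :=
    (smul_perm _ _).length_eq.trans (smul_perm _ _).length_eq.symm
  refine List.ext_getElem hlen fun i h₁ h₂ => ?_
  have hi : ∀ t, t ≤ (g • revRange n)[i] ↔ t ≤ (h • revRange n)[i] := by
    intro t
    have := congrArg (fun l => l[i]?) (key t)
    simpa [h₁, h₂] using this
  exact le_antisymm ((hi _).1 le_rfl) ((hi _).2 le_rfl)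

/-- The representation of the `0`-Hecke monoid on the unsorted binary words. -/
noncomputable def unsortedRep (k : Type*) [Field k] (n : ℕ) :
    Representation k (ZeroHeckeMonoid n) (unsortedWords n →₀ k) :=
  sinkRep k (unsortedWords n) mem_unsortedWords_of_smul

theorem unsortedRep_isEffective (k : Type*) [Field k] (n : ℕ) : (unsortedRep k n).IsEffective := by
  intro g h hgh
  refine eq_of_smul_binary_eq fun l hl => ?_
  have hg := smul_perm g l
  have hh := smul_perm h l
  by_cases hl' : l ∈ unsortedWords n
  · have hs := LinearMap.congr_fun hgh (Finsupp.single ⟨l, hl'⟩ 1)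
    by_cases h₁ : g • l ∈ unsortedWords n <;> by_cases h₂ : h • l ∈ unsortedWords n
    · rw [unsortedRep, sinkRep_single_of_mem _ _ _ h₁, sinkRep_single_of_mem _ _ _ h₂] at hs
      exact congrArg Subtype.val (Finsupp.single_left_injective one_ne_zero hs)
    · rw [unsortedRep, sinkRep_single_of_mem _ _ _ h₁, sinkRep_single_of_notMem _ _ _ h₂] at hs
      simp at hs
    · rw [unsortedRep, sinkRep_single_of_notMem _ _ _ h₁, sinkRep_single_of_mem _ _ _ h₂] at hs
      exact absurd hs.symm (by simp)
    · have e₁ : (g • l).Pairwise (· ≤ ·) := by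
        by_contra hc
        exact h₁ ⟨hg.length_eq.trans hl, hc⟩
      have e₂ : (h • l).Pairwise (· ≤ ·) := by
        by_contra hc
        exact h₂ ⟨hh.length_eq.trans hl, hc⟩
      exact List.Perm.eq_of_pairwise' e₁ e₂ (hg.trans hh.symm)
  · have hs : l.Pairwise (· ≤ ·) := by
      by_contra hc
      exact hl' ⟨hl, hc⟩
    rw [smul_eq_self_of_sorted g hl hs, smul_eq_self_of_sorted h hl hs]

theorem mk_unsortedWords (n : ℕ) : Cardinal.mk (unsortedWords n) = (2 ^ n - n - 1 : ℕ) := by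
  rw [← card_unsortedWords, Nat.cast_card]

end Upper

/-! ### Common eigenvectors and the lower bound. -/

section Lower

variable {k : Type*} [Field k] {n : ℕ}

theorem unsortedRep_eigen_apply {m : unsortedWords n →₀ k}
    (hm : ∀ i : Fin (n - 1), unsortedRep k n (heckeGen i) m = 0 ∨
      unsortedRep k n (heckeGen i) m = m) (x : ZeroHeckeMonoid n) :
    unsortedRep k n x m = 0 ∨ unsortedRep k n x m = m := by
  induction x using hecke_induction with
  | one => right; rw [map_one]; rfl
  | gen_mul i x ih =>
    rw [map_mul, Module.End.mul_apply]
    rcases ih with h | h <;> rw [h]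
    · left; rw [map_zero]
    · exact hm i

/-- The indicator function of the unsorted binary words with `c` entries `false`. -/
noncomputable def levelIndicator (k : Type*) [Field k] (n c : ℕ) (l : List Bool) : k :=
  open Classical in if l ∈ unsortedWords n ∧ l.count false = c then 1 else 0

theorem levelIndicator_of_notMem {c : ℕ} (l : List Bool) (hl : l ∉ unsortedWords n) :
    levelIndicator k n c l = 0 := if_neg fun h => hl h.1

/-- Otherwise take `A` minimal in the support and `x` sorting, within the level of `A`, only words
at most `A`. Passing from `m` to `x m` changes the coefficient sum of that level by exactly the
coefficient of `A`, yet both sums vanish. -/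
theorem exists_level_ne_zero {m : unsortedWords n →₀ k} (hm0 : m ≠ 0)
    (hm : ∀ x, unsortedRep k n x m = 0 ∨ unsortedRep k n x m = m) :
    ∃ c, Finsupp.linearCombination k
      (fun x : unsortedWords n => levelIndicator k n c x) m ≠ 0 := by
  by_contra! hc
  have hne : m.support.Nonempty := Finsupp.support_nonempty_iff.2 hm0
  obtain ⟨A, hA⟩ := m.support.exists_minimal hne
  obtain ⟨x, hx, hx'⟩ := exists_smul_sorted_le ⟨A.1, A.2.1⟩
  have h0 : Finsupp.linearCombination k (fun y : unsortedWords n =>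
      levelIndicator k n (A.1.count false) y - levelIndicator k n (A.1.count false) (x • y.1)) m
        = 0 := by
    have h1 := linearCombination_sinkRep (hS := mem_unsortedWords_of_smul)
      (levelIndicator k n (A.1.count false)) levelIndicator_of_notMem x m
    have h2 : Finsupp.linearCombination k (fun y : unsortedWords n =>
        levelIndicator k n (A.1.count false) y) (unsortedRep k n x m) = 0 := by
      rcases hm x with h | h <;> rw [h]
      · simp
      · exact hc _
    have h3 := hc (A.1.count false)
    rw [unsortedRep, h1] at h2
    rw [Finsupp.linearCombination_apply, Finsupp.sum] at h2 h3 ⊢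
    simp only [smul_sub, Finset.sum_sub_distrib, h2, h3, sub_zero]
  rw [Finsupp.linearCombination_apply, Finsupp.sum, Finset.sum_eq_single A] at h0
  · have e1 : levelIndicator k n (A.1.count false) A = 1 := if_pos ⟨A.2, rfl⟩
    have e2 : levelIndicator k n (A.1.count false) (x • A.1) = 0 :=
      levelIndicator_of_notMem _ fun h => h.2 hx
    rw [e1, e2] at h0
    exact Finsupp.mem_support_iff.1 hA.1 (by simpa using h0)
  · intro y hy hyA
    have hp := smul_perm x y.1
    by_cases hcount : y.1.count false = A.1.count false
    · have hs : ¬ (x • y.1).Pairwise (· ≤ ·) := fun hs =>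
        hyA (le_antisymm (hx' y y.2.1 hcount hs) (hA.2 hy (hx' y y.2.1 hcount hs)))
      have e1 : levelIndicator k n (A.1.count false) y = 1 := if_pos ⟨y.2, hcount⟩
      have e2 : levelIndicator k n (A.1.count false) (x • y.1) = 1 :=
        if_pos ⟨⟨hp.length_eq.trans y.2.1, hs⟩, (hp.count_eq _).trans hcount⟩
      rw [e1, e2]; simp
    · have e1 : levelIndicator k n (A.1.count false) y = 0 := if_neg fun h => hcount h.2
      have e2 : levelIndicator k n (A.1.count false) (x • y.1) = 0 :=
        if_neg fun h => hcount ((hp.count_eq _).symm.trans h.2)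
      rw [e1, e2]; simp
  · intro h; exact absurd hA.1 h

theorem sorted_of_notMem {l : List Bool} (hlen : l.length = n) (h : l ∉ unsortedWords n) :
    l.Pairwise (· ≤ ·) := by
  by_contra hc
  exact h ⟨hlen, hc⟩

/-- The common eigenvectors of the generators are multiples of the words that become sorted under
a generator. -/
theorem eigenvector_eq_single {m : unsortedWords n →₀ k} (hm0 : m ≠ 0)
    (hm : ∀ i : Fin (n - 1), unsortedRep k n (heckeGen i) m = 0 ∨
      unsortedRep k n (heckeGen i) m = m) :
    ∃ A : unsortedWords n, (∃ i : Fin (n - 1), (bubble (i : ℕ) A.1).Pairwise (· ≤ ·)) ∧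
      m = Finsupp.single A (m A) := by
  classical
  obtain ⟨c, hc⟩ := exists_level_ne_zero hm0 (unsortedRep_eigen_apply hm)
  -- A generator `i` can finish sorting a word only at level `i + 1`. On any other level it
  -- preserves the coefficient sum, so it cannot kill `m`.
  have hfix : ∀ i : Fin (n - 1), (i : ℕ) + 1 ≠ c → unsortedRep k n (heckeGen i) m = m := by
    intro i hi
    refine (hm i).resolve_left fun h0 => hc ?_
    have h1 := linearCombination_sinkRep (hS := mem_unsortedWords_of_smul)
      (levelIndicator k n c) levelIndicator_of_notMem (heckeGen i) m
    rw [← unsortedRep, h0, map_zero] at h1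
    rw [h1]
    congr 2
    funext y
    have hp := bubble_perm (i : ℕ) y.1
    rw [heckeGen_smul]
    by_cases hy : y.1.count false = c
    · have hs : ¬ (bubble (i : ℕ) y.1).Pairwise (· ≤ ·) := fun hs =>
        hi ((count_of_bubble_sorted y.2.2 hs).symm.trans hy)
      rw [levelIndicator, if_pos ⟨y.2, hy⟩, levelIndicator,
        if_pos ⟨⟨hp.length_eq.trans y.2.1, hs⟩, (hp.count_eq _).trans hy⟩]
    · rw [levelIndicator, if_neg fun h => hy h.2, levelIndicator,
        if_neg fun h => hy ((hp.count_eq _).symm.trans h.2)]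
  have hzero : ∀ (i : Fin (n - 1)) (y : unsortedWords n), bubble (i : ℕ) y.1 ≠ y.1 →
      unsortedRep k n (heckeGen i) m = m → m y = 0 := by
    intro i y hy h
    rw [← h, unsortedRep, sinkRep_apply, Finsupp.linearCombination_apply, Finsupp.sum]
    refine Finset.sum_eq_zero fun x _ => ?_
    rw [if_neg, smul_zero]
    rw [heckeGen_smul]
    intro hx
    exact hy (by rw [← hx, bubble_idem])
  have hsupp : ∀ A : unsortedWords n, m A ≠ 0 → ∃ i : Fin (n - 1), (i : ℕ) + 1 = c ∧
      bubble (i : ℕ) A.1 ≠ A.1 ∧ unsortedRep k n (heckeGen i) m = 0 := by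
    intro A hA
    obtain ⟨i, hi⟩ := exists_bubble_ne A.2
    have hne : unsortedRep k n (heckeGen i) m ≠ m := fun h => hA (hzero i A hi h)
    exact ⟨i, by by_contra h; exact hne (hfix i h), hi, (hm i).resolve_right hne⟩
  -- Every word in the support is moved by the single generator `c - 1`, which kills `m`. It is
  -- injective on the words it moves, so no cancellation occurs and each image must already be
  -- sorted.
  have hsorted : ∀ A : unsortedWords n, m A ≠ 0 → ∃ i : Fin (n - 1), (i : ℕ) + 1 = c ∧
      (bubble (i : ℕ) A.1).Pairwise (· ≤ ·) := by
    intro A hA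
    obtain ⟨i, hic, hiA, hi0⟩ := hsupp A hA
    refine ⟨i, hic, sorted_of_notMem (n := n) (by simpa using A.2.1) fun hmem => hA ?_⟩
    have h := DFunLike.congr_fun hi0 ⟨_, hmem⟩
    rw [unsortedRep, sinkRep_apply, Finsupp.linearCombination_apply, Finsupp.sum,
      Finset.sum_eq_single A] at h
    · simpa using h
    · intro y hy hyA
      rw [if_neg, smul_zero]
      rw [heckeGen_smul]
      intro hyb
      obtain ⟨j, hjc, hj, -⟩ := hsupp y (Finsupp.mem_support_iff.1 hy)
      obtain rfl : i = j := Fin.ext (by omega)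
      exact hyA (Subtype.ext (eq_of_bubble_eq hyb hj hiA))
    · intro h
      simp [Finsupp.notMem_support_iff.1 h]
  obtain ⟨A, hA⟩ := Finsupp.support_nonempty_iff.2 hm0
  rw [Finsupp.mem_support_iff] at hA
  obtain ⟨i, hic, hi⟩ := hsorted A hA
  refine ⟨A, ⟨i, hi⟩, ?_⟩
  ext B
  by_cases hB : m B = 0
  · by_cases hAB : A = B
    · exact absurd (hAB ▸ hB) hA
    · rw [hB, Finsupp.single_eq_of_ne (Ne.symm hAB)]
  · obtain ⟨j, hjc, hj⟩ := hsorted B hB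
    obtain rfl : i = j := Fin.ext (by omega)
    have : A = B := by
      refine Subtype.ext ?_
      rw [eq_of_bubble_sorted A.2.2 hi, eq_of_bubble_sorted B.2.2 hj, A.2.1, B.2.1]
    rw [this, Finsupp.single_eq_same]

variable {V : Type*} [AddCommGroup V] [Module k V]

/-- An equivariant map that does not vanish on the words that become sorted under a generator is
injective. -/
theorem linearIndependent_of_equivariant (ρ : Representation k (ZeroHeckeMonoid n) V)
    (u : List Bool → V) (hu0 : ∀ l ∉ unsortedWords n, u l = 0)
    (hu : ∀ (i : Fin (n - 1)), ∀ l ∈ unsortedWords n, ρ (heckeGen i) (u l) = u (bubble (i : ℕ) l))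
    (hne : ∀ l ∈ unsortedWords n, (∃ i : Fin (n - 1), (bubble (i : ℕ) l).Pairwise (· ≤ ·)) →
      u l ≠ 0) :
    LinearIndependent k fun l : unsortedWords n => u l := by
  classical
  rw [linearIndependent_iff]
  have hequiv : ∀ (i : Fin (n - 1)) (m : unsortedWords n →₀ k),
      Finsupp.linearCombination k (fun l : unsortedWords n => u l) m = 0 →
      Finsupp.linearCombination k (fun l : unsortedWords n => u l)
        (unsortedRep k n (heckeGen i) m) = 0 := by
    intro i m hm
    rw [unsortedRep, linearCombination_sinkRep u hu0]
    have : (fun l : unsortedWords n => u (heckeGen i • l.1)) =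
        fun l : unsortedWords n => ρ (heckeGen i) (u l) := by
      funext l; rw [hu i l l.2, heckeGen_smul]
    rw [this]
    have h := congrArg (ρ (heckeGen i)) hm
    rwa [map_zero, Finsupp.apply_linearCombination] at h
  suffices h : ∀ (A : unsortedWords n) (m : unsortedWords n →₀ k),
      Finsupp.linearCombination k (fun l : unsortedWords n => u l) m = 0 →
      (∀ B ∈ m.support, B ≤ A) → m = 0 by
    intro m hm
    by_contra hm0
    have hs := Finsupp.support_nonempty_iff.2 hm0
    exact hm0 (h (m.support.max' hs) m hm fun B hB => Finset.le_max' _ _ hB)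
  intro A
  induction A using WellFoundedLT.induction with
  | ind A ih =>
    have ih' : ∀ m : unsortedWords n →₀ k,
        Finsupp.linearCombination k (fun l : unsortedWords n => u l) m = 0 →
        (∀ B, A ≤ B → m B = 0) → m = 0 := by
      intro m hm hlt
      by_contra hm0
      have hs := Finsupp.support_nonempty_iff.2 hm0
      refine hm0 (ih (m.support.max' hs) ?_ m hm fun B hB => Finset.le_max' _ _ hB)
      by_contra h
      exact Finsupp.mem_support_iff.1 (Finset.max'_mem _ hs) (hlt _ (not_lt.1 h))
    intro m hm hle
    by_contra hm0
    have hcoef : ∀ (i : Fin (n - 1)) (B : unsortedWords n), A ≤ B →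
        unsortedRep k n (heckeGen i) m B = if bubble (i : ℕ) A.1 = B then m A else 0 := by
      intro i B hB
      rw [unsortedRep, sinkRep_apply, Finsupp.linearCombination_apply, Finsupp.sum,
        Finset.sum_eq_single A]
      · rw [heckeGen_smul, smul_eq_mul, mul_ite, mul_one, mul_zero]
      · intro y hy hyA
        rw [if_neg, smul_zero]
        rw [heckeGen_smul]
        intro h
        have h1 : y < A := (hle y hy).lt_of_ne hyA
        have h2 : B.1 ≤ y.1 := h ▸ bubble_le _ _
        exact (h1.trans_le hB).not_ge h2
      · intro h
        simp [Finsupp.notMem_support_iff.1 h]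
    -- If a generator fixes `A`, then `e_i m - m` lies in the kernel with support below `A`; if it
    -- moves `A`, then `e_i m` does. Both vanish by induction, so `m` is a common eigenvector.
    obtain ⟨C, hC, hmC⟩ := eigenvector_eq_single hm0 (by
      intro i
      by_cases hi : bubble (i : ℕ) A.1 = A.1
      · right
        rw [← sub_eq_zero]
        refine ih' _ (by rw [map_sub, hequiv i m hm, hm, sub_zero]) fun B hB => ?_
        rw [Finsupp.sub_apply, hcoef i B hB, hi]
        rcases hB.eq_or_lt with rfl | hB
        · simp
        · rw [if_neg (fun h => hB.ne (Subtype.ext h)), zero_sub, neg_eq_zero]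
          by_contra h
          exact (hle B (Finsupp.mem_support_iff.2 h)).not_gt hB
      · left
        refine ih' _ (hequiv i m hm) fun B hB => ?_
        rw [hcoef i B hB, if_neg]
        intro h
        have h1 : bubble (i : ℕ) A.1 < A.1 := (bubble_le _ _).lt_of_ne hi
        rw [h] at h1
        exact h1.not_ge hB)
    rw [hmC, Finsupp.linearCombination_single] at hm
    rcases smul_eq_zero.1 hm with h | h
    · rw [h, Finsupp.single_zero] at hmC
      exact hm0 hmC
    · exact hne C C.2 hC h

theorem card_le_rank_of_isEffective (ρ : Representation k (ZeroHeckeMonoid n) V)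
    (hρ : ρ.IsEffective) : ((2 ^ n - n - 1 : ℕ) : Cardinal) ≤ Module.rank k V := by
  classical
  have hv : ∀ c : ℕ, ∃ v : V, ∀ l ∈ unsortedWords n, l.count false = c →
      (∃ i : Fin (n - 1), (bubble (i : ℕ) l).Pairwise (· ≤ ·)) →
      ρ (wordElement n l) v ≠ ρ (wordElement n (sortedWord l)) v := by
    intro c
    by_cases h : ∃ l ∈ unsortedWords n, l.count false = c ∧
        ∃ i : Fin (n - 1), (bubble (i : ℕ) l).Pairwise (· ≤ ·)
    · obtain ⟨l, hl, hlc, i, hi⟩ := h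
      have hp : (sortedWord l).Perm l := List.perm_insertionSort _ l
      have hne : ρ (wordElement n l) ≠ ρ (wordElement n (sortedWord l)) := by
        intro h
        have := wordElement_injective hl.1 (hp.length_eq.trans hl.1) (hp.count_eq _).symm (hρ h)
        rw [this] at hl
        exact hl.2 (List.pairwise_insertionSort _ _)
      obtain ⟨v, hv⟩ : ∃ v, ρ (wordElement n l) v ≠ ρ (wordElement n (sortedWord l)) v := by
        by_contra! h
        exact hne (LinearMap.ext h)
      -- One vector serves the whole level, since its near-sorted word is unique.
      refine ⟨v, fun l' hl' hlc' ⟨j, hj⟩ => ?_⟩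
      have h1 := count_of_bubble_sorted hl.2 hi
      have h2 := count_of_bubble_sorted hl'.2 hj
      have hij : (i : ℕ) = j := by omega
      have : l' = l := by
        rw [eq_of_bubble_sorted hl.2 hi, eq_of_bubble_sorted hl'.2 hj, hl.1, hl'.1, hij]
      rwa [this]
    · exact ⟨0, fun l hl hlc hi => absurd ⟨l, hl, hlc, hi⟩ h⟩
  choose v hv using hv
  let u : List Bool → V := fun l => if l ∈ unsortedWords n then
    ρ (wordElement n l) (v (l.count false)) -
      ρ (wordElement n (sortedWord l)) (v (l.count false)) else 0
  have hli : LinearIndependent k fun l : unsortedWords n => u l := by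
    refine linearIndependent_of_equivariant ρ u (fun l hl => if_neg hl) (fun i l hl => ?_)
      fun l hl hi => ?_
    · have hp := bubble_perm (i : ℕ) l
      have hps : (sortedWord l).Perm l := List.perm_insertionSort _ l
      have hs : bubble (i : ℕ) (sortedWord l) = sortedWord l :=
        (pairwise_le_iff_bubble _).1 (List.pairwise_insertionSort _ _) i
          (by rw [hps.length_eq, hl.1]; omega)
      have hsub : ρ (heckeGen i) (u l) =
          ρ (wordElement n (bubble (i : ℕ) l)) (v (l.count false)) -
            ρ (wordElement n (sortedWord l)) (v (l.count false)) := by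
        simp only [u, if_pos hl, map_sub]
        rw [← Module.End.mul_apply, ← Module.End.mul_apply, ← map_mul, ← map_mul,
          heckeGen_mul_wordElement i hl.1,
          heckeGen_mul_wordElement i (hps.length_eq.trans hl.1), hs]
      rw [hsub]
      by_cases hb : bubble (i : ℕ) l ∈ unsortedWords n
      · simp only [u, if_pos hb]
        rw [hp.count_eq, sortedWord_eq_of_perm hp]
      · simp only [u, if_neg hb]
        have h1 := sorted_of_notMem (by simpa using hl.1) hb
        have h2 : bubble (i : ℕ) l = sortedWord l :=
          List.Perm.eq_of_pairwise' h1 (List.pairwise_insertionSort _ _) (hp.trans hps.symm)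
        rw [h2, sub_self]
    · simp only [u, if_pos hl]
      exact sub_ne_zero.2 (hv _ l hl rfl hi)
  have := hli.cardinal_lift_le_rank
  rw [mk_unsortedWords] at this
  simpa using this

end Lower

theorem mainTheorem7 (k : Type u) [Field k] (n : ℕ) (hn : 1 ≤ n) :
    IsLeast (effectiveDimensions.{u, v} k (ZeroHeckeMonoid n)) ((2 ^ n - n - 1 : ℕ) : Cardinal.{max u v}) := by
  constructor
  -- The space lives in universe `u` and is lifted to `max u v`.
  · let e : ULift.{v} (unsortedWords n →₀ k) ≃ₗ[k] (unsortedWords n →₀ k) := ULift.moduleEquiv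
    refine ⟨ULift.{v} (unsortedWords n →₀ k), inferInstance, inferInstance,
      (e.symm.conjAlgEquiv k : _ →* _).comp (unsortedRep k n), ?_, ?_⟩
    · exact (e.symm.conjAlgEquiv k).injective.comp (unsortedRep_isEffective k n)
    · rw [rank_ulift, rank_finsupp_self, mk_unsortedWords]
      simp
  · rintro d ⟨V, _, _, ρ, hρ, rfl⟩
    exact card_le_rank_of_isEffective ρ hρ
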